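/- For $A\subseteq\mathbb Z$ let $A-A=\{a-b: a,b\in A\}$ and let $\bar d(A)=\limsup_{n\to\infty}\frac{|A\cap\{1,\dots,n\}|}{n}$ be its upper asymptotic density. A set $S\subseteq\mathbb Z$ is called $\delta$-nonrecurrent if there is a set $A\subseteq\mathbb Z$ with $\bar d(A)>\delta$ and $(A-A)\cap S=\varnothing$. It is called $k$-chromatically recurrent if for every partition of $\mathbb Z$ into $k$ (possibly empty) sets $A_1,\dots,A_k$ there is some $j\le k$ with $(A_j-A_j)\cap S\neq\varnothing$. Write $\mathbb N=\{1,2,3,\dots\}$ and $mS=\{mn:n\in S\}$. Let $k,m\in\mathbb N$, let $\delta<\frac12$ be a real number, and let $E\subseteq\mathbb Z$ be infinite. Then there is a finite $\delta$-nonrecurrent set $S\subseteq\mathbb N$ such that $mS\subseteq E-E$ and $mS$ is $k$-chromatically recurrent. -/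

import Mathlib

open scoped Pointwise

/-- The upper asymptotic density `limsup_{n → ∞} |A ∩ {1, …, n}| / n` of a set of integers. The
sequence takes values in `[0, 1]`, so the real `limsup` is the genuine one. -/
noncomputable def upperDensity (A : Set ℤ) : ℝ :=
  Filter.limsup (fun n : ℕ => ((A ∩ Set.Icc 1 (n : ℤ)).ncard : ℝ) / (n : ℝ)) Filter.atTop

/-- `S` is `δ`-nonrecurrent: some `A ⊆ ℤ` of upper density greater than `δ` has a difference set
disjoint from `S`. -/
def DeltaNonrecurrent (δ : ℝ) (S : Set ℤ) : Prop :=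
  ∃ A : Set ℤ, δ < upperDensity A ∧ (A - A) ∩ S = ∅

/-- `S` is `k`-chromatically recurrent: in every partition of `ℤ` into `k` (possibly empty) cells,
some cell has a difference set meeting `S`. -/
def ChromaticallyRecurrent (k : ℕ) (S : Set ℤ) : Prop :=
  ∀ A : Fin k → Set ℤ, Pairwise (fun i j => Disjoint (A i) (A j)) → (⋃ j, A j) = Set.univ →
    ∃ j, ((A j - A j) ∩ S).Nonempty

/-- The dilate `mS = {mn : n ∈ S}`. -/
def dilate (m : ℕ) (S : Set ℤ) : Set ℤ :=
  {x | ∃ n ∈ S, x = (m : ℤ) * n}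

/-! The set `S` is modelled on a Kneser graph. Choose `M` large and attach to every `F ⊆ [2M]` an
element `e F` of the infinite set, together with one rational torus point `α`, so that `e F • α` is
close mod 1 to half the indicator of `F` (`exists_approx_half_indicator`). Let `S` consist of the
positive differences `e F - e G` over disjoint `(M - k)`-sets `F`, `G`.

Chromatic recurrence: a `k`-colouring of the integers pulls back along `e` to a colouring of the `(M
- k)`-sets, and `k` colours are too few for this Kneser graph, so two disjoint sets share a colour
(`exists_disjoint_color_eq`). This bound follows from the octahedral Tucker lemma, proved by
counting alternating flags mod 2.

Nonrecurrence: let `A` be the set of `N` for which at least `M + k + 1` coordinates of a translate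
of `N • α` lie in an interval slightly shorter than `[0, 1/2)`. By the central binomial estimate its
density can be brought near 1/2. Two members of `A` share at least `2k + 2` such coordinates, where
their difference stays away from 1/2; but a difference `e F - e G` is near 1/2 at all except `2k`
coordinates (`exists_dense_avoiding`).

The factor `m` is absorbed by passing to a residue class mod `m` that contains infinitely many
elements of `E`. -/

/-! ### Alternating signed labels mod 2 -/

/-- A natural number `c` encodes the nonzero signed label with absolute value `c / 2` and sign given
by the parity of `c`. This is the parity indicator of "the signs alternate, starting with `s`". -/
def altIndicator : Bool → List ℕ → ZMod 2
  | _, [] => 1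
  | s, b :: t => if b.bodd = s then altIndicator (!s) t else 0

/-- This is the boundary relation of the parity argument. If the head has sign `s`, the
contributions from deleting it and from deleting later entries overlap and cancel mod 2; if not,
only deleting the head can leave a list starting with `s`. Sortedness makes equal entries adjacent,
so it is immaterial which copy is erased. -/
theorem sum_altIndicator_erase (l : List ℕ) (hl : l.Pairwise (· ≤ ·)) (s : Bool) :
    (l.map fun a => altIndicator s (l.erase a)).sum = altIndicator s l + altIndicator (!s) l := by
  induction l generalizing s with
  | nil => simp only [List.map_nil, List.sum_nil, altIndicator]; decide
  | cons b t ih =>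
    have ht := (List.pairwise_cons.1 hl)
    have h1 : (t.map fun a => altIndicator s ((b :: t).erase a)) =
        t.map fun a => altIndicator s (b :: t.erase a) := by
      refine List.map_congr_left fun a ha => ?_
      by_cases hab : b = a
      · subst hab
        cases t with
        | nil => simp at ha
        | cons c t =>
          have h2 : b ≤ c := ht.1 c (by simp)
          have h3 : c ≤ b := by
            rcases List.mem_cons.1 ha with h | h
            · exact h.ge
            · exact (List.pairwise_cons.1 ht.2).1 b h
          obtain rfl := le_antisymm h2 h3
          simp
      · rw [List.erase_cons_tail (by simpa using hab)]
    rw [List.map_cons, List.sum_cons, h1, List.erase_cons_head]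
    simp only [altIndicator, Bool.not_not]
    by_cases hb : b.bodd = s
    · have : ¬ b.bodd = !s := by rw [hb]; cases s <;> simp
      simp only [hb, if_true, ih ht.2, Bool.not_not]
      have h2 := CharTwo.add_self_eq_zero (altIndicator s t)
      have h3 : ¬ s = !s := by cases s <;> simp
      rw [if_neg h3]
      linear_combination h2
    · have : b.bodd = !s := by revert hb; cases s <;> cases b.bodd <;> simp
      simp [this]

/-- The parity indicator of "the labels, sorted by absolute value, alternate in sign". -/
def altParity (s : Bool) (M : Multiset ℕ) : ZMod 2 := altIndicator s (M.sort (· ≤ ·))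

theorem sort_erase (M : Multiset ℕ) (a : ℕ) :
    (M.erase a).sort (· ≤ ·) = (M.sort (· ≤ ·)).erase a := by
  refine List.Perm.eq_of_pairwise' (r := (· ≤ ·)) ?_ ?_ ?_
  · exact Multiset.pairwise_sort _ _
  · exact (Multiset.pairwise_sort M _).sublist List.erase_sublist
  · rw [← Multiset.coe_eq_coe, ← Multiset.coe_erase]; simp

theorem sum_altParity_erase (M : Multiset ℕ) (s : Bool) :
    (M.map fun a => altParity s (M.erase a)).sum = altParity s M + altParity (!s) M := by
  have := sum_altIndicator_erase (M.sort (· ≤ ·)) (Multiset.pairwise_sort _ _) s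
  unfold altParity
  rw [← this]
  conv_lhs => enter [1, 2]; rw [← Multiset.sort_eq M (· ≤ ·)]
  rw [Multiset.map_coe, Multiset.sum_coe]
  simp only [sort_erase]

/-- The label with the opposite sign. -/
def flipLabel (c : ℕ) : ℕ := if c.bodd then c - 1 else c + 1

theorem bodd_flipLabel (c : ℕ) : (flipLabel c).bodd = !c.bodd := by
  unfold flipLabel
  have := Nat.mod_two_of_bodd c
  rcases h : c.bodd
  · simp [h]
  · obtain ⟨e, rfl⟩ : ∃ e, c = e + 1 := ⟨c - 1, by rw [h] at this; simp at this; omega⟩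
    simpa using h

theorem flipLabel_div_two (c : ℕ) : flipLabel c / 2 = c / 2 := by
  unfold flipLabel
  have := Nat.mod_two_of_bodd c
  split_ifs with h
  · simp [h] at this; omega
  · simp [h] at this; omega

theorem eq_or_eq_flipLabel {a b : ℕ} (h : a / 2 = b / 2) : a = b ∨ flipLabel a = b := by
  unfold flipLabel
  have := Nat.mod_two_of_bodd a
  split_ifs with h
  · simp [h] at this; omega
  · simp [h] at this; omega

theorem altIndicator_map_flipLabel (l : List ℕ) (s : Bool) :
    altIndicator s (l.map flipLabel) = altIndicator (!s) l := by
  induction l generalizing s with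
  | nil => rfl
  | cons b t ih =>
    simp only [List.map_cons, altIndicator, ih, bodd_flipLabel]
    rcases b.bodd <;> cases s <;> simp

/-- A code and its flip have the same absolute value, so flipping can disturb the sorted order only
between opposite labels, and these are excluded. -/
theorem altParity_map_flipLabel (M : Multiset ℕ) (hM : ∀ a ∈ M, ∀ b ∈ M, flipLabel a ≠ b)
    (s : Bool) : altParity s (M.map flipLabel) = altParity (!s) M := by
  unfold altParity
  rw [← altIndicator_map_flipLabel]
  congr 1
  refine List.Perm.eq_of_pairwise' (r := (· ≤ ·)) (Multiset.pairwise_sort _ _) ?_ ?_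
  · rw [List.pairwise_map]
    refine (Multiset.pairwise_sort M (· ≤ ·)).imp_of_mem fun {a b} ha hb hab => ?_
    rw [Multiset.mem_sort] at ha hb
    rcases hab.eq_or_lt with rfl | hlt
    · rfl
    · have h1 : a / 2 ≠ b / 2 := fun h => by
        rcases eq_or_eq_flipLabel h with h | h
        · omega
        · exact hM a ha b hb h
      have := flipLabel_div_two a
      have := flipLabel_div_two b
      omega
  · rw [← Multiset.coe_eq_coe, ← Multiset.map_coe]; simp

/-! ### Flags of sign vectors -/

/-- A full flag of sign vectors: coordinate `i` becomes nonzero at time `φ.1 i`, with sign `φ.2 i`. -/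
abbrev SignFlag (n : ℕ) := Equiv.Perm (Fin n) × (Fin n → Bool)

namespace SignFlag

variable {n : ℕ}

/-- The `j`-th sign vector of a flag. -/
def vertex (φ : SignFlag n) (j : ℕ) : Fin n → SignType :=
  fun i => if (φ.1 i : ℕ) ≤ j then (if φ.2 i then 1 else -1) else 0

/-- Flags whose permutation fixes all `i ≥ a` and whose signs are positive at all `i ≥ b`. -/
def fixing (n a b : ℕ) : Finset (SignFlag n) :=
  Finset.univ.filter fun φ => (∀ i : Fin n, a ≤ i → φ.1 i = i) ∧ ∀ i : Fin n, b ≤ i → φ.2 i = true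

theorem mem_fixing {a b : ℕ} {φ : SignFlag n} : φ ∈ fixing n a b ↔
    (∀ i : Fin n, a ≤ i → φ.1 i = i) ∧ ∀ i : Fin n, b ≤ i → φ.2 i = true := by
  simp [fixing]

/-- The labels of the first `d` vectors of a flag. -/
def labels (lam : (Fin n → SignType) → ℕ) (φ : SignFlag n) (d : ℕ) : Multiset ℕ :=
  (Multiset.range d).map fun j => lam (φ.vertex j)

theorem labels_erase (lam : (Fin n → SignType) → ℕ) (φ : SignFlag n) {d j : ℕ} (hj : j < d) :
    (labels lam φ d).erase (lam (φ.vertex j)) =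
      ((Multiset.range d).erase j).map fun i => lam (φ.vertex i) := by
  rw [labels, Multiset.map_erase_of_mem _ _ (by simpa using hj)]

theorem labels_erase_last (lam : (Fin n → SignType) → ℕ) (φ : SignFlag n) (d : ℕ) :
    (labels lam φ (d + 1)).erase (lam (φ.vertex d)) = labels lam φ d := by
  rw [labels, Multiset.range_succ, Multiset.map_cons, Multiset.erase_cons_head, labels]

theorem vertex_ne_zero (φ : SignFlag n) {j : ℕ} (hj : j < n) : φ.vertex j ≠ 0 := by
  intro h
  have := congrFun h (φ.1.symm ⟨j, hj⟩)
  simp only [vertex, Equiv.apply_symm_apply, le_refl, if_true, Pi.zero_apply] at this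
  split_ifs at this

theorem vertex_mono (φ : SignFlag n) {j k : ℕ} (hjk : j ≤ k) (i : Fin n)
    (hi : φ.vertex j i ≠ 0) : φ.vertex k i = φ.vertex j i := by
  unfold vertex at *
  split_ifs at * <;> first | rfl | omega | simp_all

theorem vertex_congr {φ ψ : SignFlag n} {j : ℕ} (h₁ : ∀ x, (ψ.1 x : ℕ) ≤ j ↔ (φ.1 x : ℕ) ≤ j)
    (h₂ : ∀ x, (φ.1 x : ℕ) ≤ j → ψ.2 x = φ.2 x) : ψ.vertex j = φ.vertex j := by
  ext x
  unfold vertex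
  by_cases hx : (φ.1 x : ℕ) ≤ j
  · rw [if_pos hx, if_pos ((h₁ x).2 hx)]
    simp only [h₂ x hx]
  · rw [if_neg hx, if_neg (mt (h₁ x).1 hx)]

/-- Exchange times `j` and `j + 1`. -/
def exchange (φ : SignFlag n) (j : ℕ) (hj : j + 1 < n) : SignFlag n :=
  (Equiv.swap ⟨j, by omega⟩ ⟨j + 1, hj⟩ * φ.1, φ.2)

theorem exchange_exchange (φ : SignFlag n) (j : ℕ) (hj : j + 1 < n) :
    (φ.exchange j hj).exchange j hj = φ := by
  unfold exchange
  ext : 1 <;> simp [← mul_assoc]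

theorem exchange_ne (φ : SignFlag n) (j : ℕ) (hj : j + 1 < n) : φ.exchange j hj ≠ φ := by
  intro h
  have := congrArg Prod.fst h
  simp only [exchange, mul_eq_right, Equiv.swap_eq_one_iff, Fin.mk.injEq] at this
  omega

theorem vertex_exchange (φ : SignFlag n) {i j : ℕ} (hj : j + 1 < n) (hij : i ≠ j) :
    (φ.exchange j hj).vertex i = φ.vertex i := by
  have key (y : Fin n) : (Equiv.swap (⟨j, by omega⟩ : Fin n) ⟨j + 1, hj⟩ y : ℕ) ≤ i ↔ (y : ℕ) ≤ i := by
    rw [Equiv.swap_apply_def]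
    split_ifs with h1 h2
    · subst h1; simp only; omega
    · subst h2; simp only; omega
    · rfl
  exact vertex_congr (fun x => key (φ.1 x)) fun _ _ => rfl

theorem exchange_mem {a b : ℕ} {φ : SignFlag n} {j : ℕ} (hj : j + 1 < n) (hja : j + 1 < a)
    (h : φ ∈ fixing n a b) : φ.exchange j hj ∈ fixing n a b := by
  rw [mem_fixing] at *
  refine ⟨fun i hi => ?_, h.2⟩
  simp only [exchange, Equiv.Perm.mul_apply, h.1 i hi]
  apply Equiv.swap_apply_of_ne_of_ne <;> rw [Ne, Fin.ext_iff] <;> simp only <;> omega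

/-- Change the sign of the coordinate which becomes nonzero at time `d`. -/
def flipAt (φ : SignFlag n) (d : Fin n) : SignFlag n :=
  (φ.1, Function.update φ.2 (φ.1.symm d) (!φ.2 (φ.1.symm d)))

theorem flipAt_flipAt (φ : SignFlag n) (d : Fin n) : (φ.flipAt d).flipAt d = φ := by
  simp [flipAt]

theorem flipAt_ne (φ : SignFlag n) (d : Fin n) : φ.flipAt d ≠ φ := by
  intro h
  have := congrFun (congrArg Prod.snd h) (φ.1.symm d)
  simp [flipAt] at this

theorem vertex_flipAt (φ : SignFlag n) {d : Fin n} {i : ℕ} (hi : i < d) :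
    (φ.flipAt d).vertex i = φ.vertex i := by
  refine vertex_congr (fun _ => Iff.rfl) fun x hx => Function.update_of_ne ?_ _ _
  rintro rfl
  rw [Equiv.apply_symm_apply] at hx
  omega

/-- Change the signs of all coordinates up to `d`. -/
def negate (φ : SignFlag n) (d : ℕ) : SignFlag n :=
  (φ.1, fun i => if (i : ℕ) ≤ d then !φ.2 i else φ.2 i)

theorem negate_negate (φ : SignFlag n) (d : ℕ) : (φ.negate d).negate d = φ := by
  unfold negate
  ext i
  · rfl
  · simp only; split_ifs <;> simp

theorem vertex_negate {φ : SignFlag n} {b d i : ℕ} (h : φ ∈ fixing n (d + 1) b) (hi : i ≤ d) :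
    (φ.negate d).vertex i = -φ.vertex i := by
  ext x
  simp only [vertex, negate, Pi.neg_apply]
  by_cases hx : (φ.1 x : ℕ) ≤ i
  · have : (x : ℕ) ≤ d := by
      by_contra hc
      rw [(mem_fixing.1 h).1 x (by omega)] at hx
      omega
    simp only [hx, this, if_true]
    cases φ.2 x <;> simp
  · simp [hx]

end SignFlag

/-! ### Tucker's lemma by parity -/

theorem flipLabel_flipLabel (c : ℕ) : flipLabel (flipLabel c) = c := by
  have h := bodd_flipLabel c
  rcases eq_or_eq_flipLabel (flipLabel_div_two c) with h' | h'
  · rw [h'] at h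
    cases h2 : c.bodd <;> simp [h2] at h
  · exact h'

/-- An antipodal labelling of the nonzero sign vectors in which no vector has the label opposite to
that of an extension of it. -/
structure IsTuckerLabelling {n : ℕ} (lam : (Fin n → SignType) → ℕ) : Prop where
  neg : ∀ x, x ≠ 0 → lam (-x) = flipLabel (lam x)
  compl : ∀ x y, x ≠ 0 → (∀ i, x i ≠ 0 → y i = x i) → flipLabel (lam x) ≠ lam y

namespace SignFlag

variable {n : ℕ} {lam : (Fin n → SignType) → ℕ}

theorem flipLabel_ne_of_mem_labels (h : IsTuckerLabelling lam) (φ : SignFlag n) {d : ℕ}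
    (hd : d ≤ n) : ∀ a ∈ labels lam φ d, ∀ b ∈ labels lam φ d, flipLabel a ≠ b := by
  simp only [labels, Multiset.mem_map, Multiset.mem_range, forall_exists_index, and_imp,
    forall_apply_eq_imp_iff₂]
  intro j hj k hk
  rcases le_total j k with hjk | hjk
  · exact h.compl _ _ (φ.vertex_ne_zero (by omega)) (φ.vertex_mono hjk)
  · intro he
    refine h.compl _ _ (φ.vertex_ne_zero (by omega)) (φ.vertex_mono hjk) ?_
    rw [← he, flipLabel_flipLabel]

theorem labels_negate (h : IsTuckerLabelling lam) {φ : SignFlag n} {b d : ℕ}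
    (hφ : φ ∈ fixing n (d + 1) b) (hd : d < n) :
    labels lam (φ.negate d) (d + 1) = (labels lam φ (d + 1)).map flipLabel := by
  rw [labels, labels, Multiset.map_map]
  refine Multiset.map_congr rfl fun j hj => ?_
  rw [Multiset.mem_range] at hj
  rw [vertex_negate hφ (by omega), Function.comp_apply, h.neg _ (φ.vertex_ne_zero (by omega))]

/-- Splitting a sphere into two antipodal hemispheres. -/
theorem sum_sphere_eq_sum_hemisphere (h : IsTuckerLabelling lam) {d : ℕ} (hd : d < n) (s : Bool) :
    ∑ φ ∈ fixing n (d + 1) (d + 1), altParity s (labels lam φ (d + 1)) =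
      ∑ φ ∈ fixing n (d + 1) d,
        (altParity s (labels lam φ (d + 1)) + altParity (!s) (labels lam φ (d + 1))) := by
  rw [Finset.sum_add_distrib,
    ← Finset.sum_filter_add_sum_filter_not _ (fun φ : SignFlag n => φ.2 ⟨d, hd⟩ = true)]
  have key (i : Fin n) (hi : d ≤ i) : i = ⟨d, hd⟩ ∨ d + 1 ≤ (i : ℕ) := by
    rw [Fin.ext_iff]; simp only; omega
  congr 1
  · refine Finset.sum_congr ?_ fun _ _ => rfl
    ext φ
    simp only [Finset.mem_filter, mem_fixing]
    constructor
    · rintro ⟨⟨h1, h2⟩, h3⟩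
      refine ⟨h1, fun i hi => ?_⟩
      rcases key i hi with rfl | h
      · exact h3
      · exact h2 i h
    · rintro ⟨h1, h2⟩
      exact ⟨⟨h1, fun i hi => h2 i (by omega)⟩, h2 _ le_rfl⟩
  · refine Finset.sum_bij' (fun φ _ => φ.negate d) (fun φ _ => φ.negate d) ?_ ?_
      (fun φ _ => negate_negate φ d) (fun φ _ => negate_negate φ d) ?_
    · intro φ hφ
      simp only [Finset.mem_filter, mem_fixing] at hφ ⊢
      refine ⟨hφ.1.1, fun i hi => ?_⟩
      rcases key i hi with rfl | h
      · simpa [negate] using hφ.2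
      · simpa [negate, show ¬ (i : ℕ) ≤ d by omega] using hφ.1.2 i h
    · intro φ hφ
      simp only [Finset.mem_filter, mem_fixing] at hφ ⊢
      refine ⟨⟨hφ.1, fun i hi => ?_⟩, ?_⟩
      · simpa [negate, show ¬ (i : ℕ) ≤ d by omega] using hφ.2 i (by omega)
      · simpa [negate] using hφ.2 ⟨d, hd⟩ le_rfl
    · intro φ hφ
      rw [labels_negate h (Finset.mem_filter.1 hφ).1 hd, altParity_map_flipLabel, Bool.not_not]
      exact flipLabel_ne_of_mem_labels h φ hd

/-- The facets opposite to a vertex other than the last one cancel in pairs. -/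
theorem sum_interior_facets {d j : ℕ} (hd : d < n) (hj : j < d) (s : Bool) :
    ∑ φ ∈ fixing n (d + 1) d,
      altParity s ((labels lam φ (d + 1)).erase (lam (φ.vertex j))) = 0 := by
  -- Exchanging times `j` and `j + 1` changes only the vertex `j`, which has been deleted.
  refine Finset.sum_involution (fun φ _ => φ.exchange j (by omega)) ?_ ?_ ?_ ?_
  · intro φ _
    rw [labels_erase _ _ (by omega), labels_erase _ _ (by omega)]
    convert CharTwo.add_self_eq_zero (R := ZMod 2) _ using 3
    refine Multiset.map_congr rfl fun i hi => ?_
    rw [vertex_exchange]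
    rintro rfl
    exact (Multiset.nodup_range _).notMem_erase hi
  · exact fun φ _ _ => φ.exchange_ne j _
  · exact fun φ hφ => exchange_mem _ (by omega) hφ
  · exact fun φ _ => φ.exchange_exchange j _

/-- The facets opposite to the last vertex cancel in pairs, except those on the boundary. -/
theorem sum_last_facets {d : ℕ} (hd : d < n) (s : Bool) :
    ∑ φ ∈ fixing n (d + 1) d, altParity s (labels lam φ d) =
      ∑ φ ∈ fixing n d d, altParity s (labels lam φ d) := by
  have key (i : Fin n) (hi : d ≤ i) : i = ⟨d, hd⟩ ∨ d + 1 ≤ (i : ℕ) := by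
    rw [Fin.ext_iff]; simp only; omega
  rw [← Finset.sum_filter_add_sum_filter_not _ (fun φ : SignFlag n => φ.1 ⟨d, hd⟩ = ⟨d, hd⟩)]
  have h0 : ∑ φ ∈ (fixing n (d + 1) d).filter fun φ => ¬ φ.1 ⟨d, hd⟩ = ⟨d, hd⟩,
      altParity s (labels lam φ d) = 0 := by
    -- Here the coordinate entering at time `d` has index below `d`, so its sign is unrestricted;
    -- reversing it leaves all vertices before time `d` alone.
    refine Finset.sum_involution (fun φ _ => φ.flipAt ⟨d, hd⟩) ?_ ?_ ?_ ?_
    · intro φ _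
      convert CharTwo.add_self_eq_zero (R := ZMod 2) _ using 3
      refine Multiset.map_congr rfl fun i hi => ?_
      rw [vertex_flipAt]
      simpa using hi
    · exact fun φ _ _ => φ.flipAt_ne _
    · intro φ hφ
      simp only [Finset.mem_filter, mem_fixing] at hφ ⊢
      refine ⟨⟨hφ.1.1, fun i hi => ?_⟩, hφ.2⟩
      rw [← hφ.1.2 i hi]
      refine Function.update_of_ne ?_ _ _
      intro he
      have h1 : φ.1 i = ⟨d, hd⟩ := by rw [he, Equiv.apply_symm_apply]
      rcases key i hi with rfl | h
      · exact hφ.2 h1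
      · rw [hφ.1.1 i h] at h1
        rw [h1] at h
        simp at h
    · exact fun φ _ => φ.flipAt_flipAt _
  rw [h0, add_zero]
  refine Finset.sum_congr ?_ fun _ _ => rfl
  ext φ
  simp only [Finset.mem_filter, mem_fixing]
  constructor
  · rintro ⟨⟨h1, h2⟩, h3⟩
    refine ⟨fun i hi => ?_, h2⟩
    rcases key i hi with rfl | h
    · exact h3
    · exact h1 i h
  · rintro ⟨h1, h2⟩
    exact ⟨⟨fun i hi => h1 i (by omega), h2⟩, h1 _ le_rfl⟩

/-- Induction on dimension: `fixing n d d` lists the top simplices of a subdivided `(d - 1)`-sphere.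
Folding the next sphere onto a hemisphere turns the count of alternating simplices starting with `+`
into a count with either starting sign, which by the boundary relation counts alternating facets.
Interior facets cancel in pairs, and the rest form the equator. -/
theorem sum_sphere (h : IsTuckerLabelling lam) {d : ℕ} (hd : d ≤ n) :
    ∑ φ ∈ fixing n d d, altParity true (labels lam φ d) = 1 := by
  induction d with
  | zero =>
    have : fixing n 0 0 = {(1, fun _ => true)} := by
      ext φ
      simp only [mem_fixing, Finset.mem_singleton, Nat.zero_le, true_imp_iff]
      constructor
      · rintro ⟨h1, h2⟩
        exact Prod.ext (Equiv.ext h1) (funext h2)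
      · rintro rfl
        simp
    rw [this, Finset.sum_singleton]
    simp [labels, altParity, altIndicator]
  | succ d ih =>
    rw [sum_sphere_eq_sum_hemisphere h hd]
    simp only [← sum_altParity_erase]
    have (φ : SignFlag n) : ((labels lam φ (d + 1)).map fun a =>
        altParity true ((labels lam φ (d + 1)).erase a)).sum = ∑ j ∈ Finset.range (d + 1),
          altParity true ((labels lam φ (d + 1)).erase (lam (φ.vertex j))) := by
      conv_lhs => enter [1, 2]; rw [labels]
      rw [Multiset.map_map]
      rfl
    simp only [this]
    rw [Finset.sum_comm, Finset.sum_range_succ, Finset.sum_eq_zero, zero_add]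
    · simp only [labels_erase_last]
      rw [sum_last_facets (by omega), ih (by omega)]
    · exact fun j hj => sum_interior_facets (by omega) (Finset.mem_range.1 hj) _

end SignFlag

/-- Consecutive signs differ and opposite labels do not both occur, so absolute values strictly
increase within `[p, m)`. -/
theorem length_le_of_altIndicator_ne_zero {l : List ℕ} (hl : l.Pairwise (· ≤ ·))
    (hc : ∀ a ∈ l, ∀ b ∈ l, flipLabel a ≠ b) {s : Bool} (h : altIndicator s l ≠ 0) {p m : ℕ}
    (hp : ∀ a ∈ l, p ≤ a / 2) (hm : ∀ a ∈ l, a / 2 < m) : l.length ≤ m - p := by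
  induction l generalizing s p with
  | nil => simp
  | cons b t ih =>
    have hb : b.bodd = s := by
      by_contra hb
      simp [altIndicator, hb] at h
    have h' : altIndicator (!s) t ≠ 0 := by simpa [altIndicator, hb] using h
    have hpb := hp b (by simp)
    have hmb := hm b (by simp)
    have hlt : ∀ a ∈ t, b < a := by
      cases t with
      | nil => simp
      | cons c t =>
        have hcs : c.bodd = !s := by
          by_contra hb
          simp [altIndicator, hb] at h'
        have hbc : b < c := by
          refine lt_of_le_of_ne ((List.pairwise_cons.1 hl).1 c (by simp)) ?_
          rintro rfl
          rw [hb] at hcs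
          cases s <;> simp at hcs
        intro a ha
        rcases List.mem_cons.1 ha with rfl | ha
        · exact hbc
        · exact hbc.trans_le ((List.pairwise_cons.1 (List.pairwise_cons.1 hl).2).1 a ha)
    have := ih (List.pairwise_cons.1 hl).2
      (fun a ha c hc' => hc a (by simp [ha]) c (by simp [hc'])) h' (p := p + 1)
      (fun a ha => by
        have h1 := hlt a ha
        have h2 : b / 2 ≠ a / 2 := fun he => by
          rcases eq_or_eq_flipLabel he with he | he
          · omega
          · exact hc b (by simp) a (by simp [ha]) he
        omega)
      (fun a ha => hm a (by simp [ha]))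
    rw [List.length_cons]
    omega

/-- The octahedral Tucker lemma. -/
theorem IsTuckerLabelling.dim_le {n m : ℕ} {lam : (Fin n → SignType) → ℕ}
    (h : IsTuckerLabelling lam) (hm : ∀ x, x ≠ 0 → lam x / 2 < m) : n ≤ m := by
  obtain ⟨φ, -, hφ⟩ := Finset.exists_ne_zero_of_sum_ne_zero
    ((SignFlag.sum_sphere h le_rfl).trans_ne one_ne_zero)
  have := length_le_of_altIndicator_ne_zero (Multiset.pairwise_sort _ _)
    (by simpa only [Multiset.mem_sort] using SignFlag.flipLabel_ne_of_mem_labels h φ le_rfl)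
    hφ (p := 0) (m := m) (by simp) (by
      intro a ha
      simp only [Multiset.mem_sort, SignFlag.labels, Multiset.mem_map, Multiset.mem_range] at ha
      obtain ⟨j, hj, rfl⟩ := ha
      exact hm _ (φ.vertex_ne_zero hj))
  simpa [SignFlag.labels] using this

/-! ### Chromatic number of Kneser graphs -/

/-- The label with absolute value `v` and sign `b`. -/
def mkLabel (v : ℕ) (b : Bool) : ℕ := Nat.bit b v

theorem mkLabel_div_two (v : ℕ) (b : Bool) : mkLabel v b / 2 = v := Nat.bit_div_two b v

theorem flipLabel_mkLabel (v : ℕ) (b : Bool) : flipLabel (mkLabel v b) = mkLabel v (!b) := by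
  unfold mkLabel flipLabel
  rw [Nat.bodd_bit]
  cases b <;> simp [Nat.bit_val]

theorem mkLabel_inj {v w : ℕ} {b c : Bool} : mkLabel v b = mkLabel w c ↔ v = w ∧ b = c := by
  unfold mkLabel
  cases b <;> cases c <;> simp [Nat.bit_val] <;> omega

namespace SignVector

variable {n : ℕ}

/-- The coordinates at which a sign vector is positive. -/
def posPart (x : Fin n → SignType) : Finset (Fin n) := Finset.univ.filter fun i => x i = 1

/-- The coordinates at which a sign vector is nonzero. -/
def support (x : Fin n → SignType) : Finset (Fin n) := Finset.univ.filter fun i => x i ≠ 0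

theorem mem_posPart {x : Fin n → SignType} {i : Fin n} : i ∈ posPart x ↔ x i = 1 := by
  simp [posPart]

theorem mem_posPart_neg {x : Fin n → SignType} {i : Fin n} : i ∈ posPart (-x) ↔ x i = -1 := by
  simp [posPart, neg_eq_iff_eq_neg]

theorem mem_support {x : Fin n → SignType} {i : Fin n} : i ∈ support x ↔ x i ≠ 0 := by
  simp [support]

theorem support_neg (x : Fin n → SignType) : support (-x) = support x := by
  ext i
  rw [mem_support, mem_support, Pi.neg_apply]
  cases x i <;> decide

theorem disjoint_posPart_neg (x : Fin n → SignType) : Disjoint (posPart x) (posPart (-x)) := by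
  rw [Finset.disjoint_left]
  intro i h1 h2
  rw [mem_posPart] at h1
  rw [mem_posPart_neg, h1] at h2
  exact absurd h2 (by decide)

theorem card_support (x : Fin n → SignType) :
    (support x).card = (posPart x).card + (posPart (-x)).card := by
  rw [← Finset.card_union_of_disjoint (disjoint_posPart_neg x)]
  congr 1
  ext i
  rw [Finset.mem_union, mem_posPart, mem_posPart_neg, mem_support]
  cases x i <;> decide

theorem support_nonempty {x : Fin n → SignType} (hx : x ≠ 0) : (support x).Nonempty := by
  obtain ⟨i, hi⟩ := Function.ne_iff.1 hx
  exact ⟨i, mem_support.2 hi⟩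

/-- The first nonzero coordinate is positive. -/
def LeadPos (x : Fin n → SignType) : Prop := ∃ i, x i = 1 ∧ ∀ j < i, x j = 0

theorem leadPos_neg {x : Fin n → SignType} (hx : x ≠ 0) : LeadPos (-x) ↔ ¬ LeadPos x := by
  constructor
  · rintro ⟨i, hi, hi'⟩ ⟨j, hj, hj'⟩
    simp only [Pi.neg_apply, neg_eq_iff_eq_neg] at hi hi'
    rcases lt_trichotomy i j with h | h | h
    · rw [hj' i h] at hi; exact absurd hi (by decide)
    · rw [h, hj] at hi; exact absurd hi (by decide)
    · rw [hi' j h] at hj; exact absurd hj (by decide)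
  · intro h
    have hs := support_nonempty hx
    refine ⟨(support x).min' hs, ?_, fun j hj => ?_⟩
    · have h1 := mem_support.1 ((support x).min'_mem hs)
      have h2 : x ((support x).min' hs) ≠ 1 := fun h2 => h ⟨_, h2, fun j hj => by
        by_contra hc
        exact absurd ((support x).min'_le j (mem_support.2 hc)) (not_le.2 hj)⟩
      rw [Pi.neg_apply]
      revert h1 h2
      cases x ((support x).min' hs) <;> decide
    · by_contra hc
      refine absurd ((support x).min'_le j (mem_support.2 ?_)) (not_le.2 hj)
      rintro h0
      simp [h0] at hc

theorem posPart_mono {x y : Fin n → SignType} (h : ∀ i, x i ≠ 0 → y i = x i) :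
    posPart x ⊆ posPart y := fun i hi => by
  rw [mem_posPart] at *
  rw [h i (by rw [hi]; decide), hi]

theorem eq_of_card_support_eq {x y : Fin n → SignType} (h : ∀ i, x i ≠ 0 → y i = x i)
    (hc : (support x).card = (support y).card) : x = y := by
  have hs : support x = support y := by
    refine Finset.eq_of_subset_of_card_le (fun i hi => ?_) hc.ge
    rw [mem_support] at *
    rwa [h i hi]
  ext i
  by_cases hi : x i = 0
  · have : i ∉ support y := by rw [← hs, mem_support]; simpa using hi
    rw [mem_support, not_not] at this
    rw [hi, this]
  · rw [h i hi]

end SignVector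

open SignVector

/-- The least colour of an `r`-subset of `B`, and `k` if there is none. -/
def minColor {n : ℕ} (r k : ℕ) (c : Finset (Fin n) → ℕ) (B : Finset (Fin n)) : ℕ :=
  (insert k ((B.powersetCard r).image c)).min' (Finset.insert_nonempty _ _)

section minColor

variable {n r k : ℕ} {c : Finset (Fin n) → ℕ} {B : Finset (Fin n)}

theorem exists_of_minColor_lt (h : minColor r k c B < k) :
    ∃ G ⊆ B, G.card = r ∧ c G = minColor r k c B := by
  have := Finset.min'_mem (insert k ((B.powersetCard r).image c)) (Finset.insert_nonempty _ _)
  rw [Finset.mem_insert, Finset.mem_image] at this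
  rcases this with h' | ⟨G, hG, hG'⟩
  · exact absurd h' h.ne
  · rw [Finset.mem_powersetCard] at hG
    exact ⟨G, hG.1, hG.2, hG'⟩

theorem minColor_lt (hc : ∀ G, c G < k) (hB : r ≤ B.card) : minColor r k c B < k := by
  obtain ⟨G, hG⟩ := Finset.powersetCard_nonempty.2 hB
  exact (Finset.min'_le _ _ (Finset.mem_insert_of_mem (Finset.mem_image_of_mem c hG))).trans_lt
    (hc G)

end minColor

open Classical in
/-- The labelling of sign vectors obtained from a colouring of the `r`-subsets. -/
noncomputable def kneserLabel {n : ℕ} (r k : ℕ) (c : Finset (Fin n) → ℕ) (x : Fin n → SignType) : ℕ :=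
  if (support x).card ≤ 2 * r - 2 then mkLabel ((support x).card - 1) (decide (LeadPos x))
  else mkLabel (2 * r - 2 + min (minColor r k c (posPart x)) (minColor r k c (posPart (-x))))
    (decide (minColor r k c (posPart x) < minColor r k c (posPart (-x))))

/-- The lower bound for the chromatic number of Kneser graphs. -/
theorem exists_disjoint_color_eq {n r k : ℕ} (hr : 1 ≤ r) (hn : 2 * r + k ≤ n + 1)
    (c : Finset (Fin n) → ℕ) (hc : ∀ G, c G < k) :
    ∃ F G, F.card = r ∧ G.card = r ∧ Disjoint F G ∧ c F = c G := by
  by_contra! hne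
  have hlt (x : Fin n → SignType) (hx : ¬ (support x).card ≤ 2 * r - 2) :
      min (minColor r k c (posPart x)) (minColor r k c (posPart (-x))) < k := by
    rw [card_support] at hx
    rw [min_lt_iff]
    -- A support of size at least `2r - 1` has a positive or a negative part with at least `r`
    -- elements.
    by_cases h : r ≤ (posPart x).card
    · exact Or.inl (minColor_lt hc h)
    · exact Or.inr (minColor_lt hc (by omega))
  have hdis (B C : Finset (Fin n)) (hBC : Disjoint B C) (hB : minColor r k c B < k) :
      minColor r k c B ≠ minColor r k c C := by
    intro he
    obtain ⟨F, hF, hFr, hFc⟩ := exists_of_minColor_lt hB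
    obtain ⟨G, hG, hGr, hGc⟩ := exists_of_minColor_lt (he ▸ hB)
    exact hne F G hFr hGr (Finset.disjoint_of_subset_left hF (Finset.disjoint_of_subset_right hG hBC))
      (by rw [hFc, hGc, he])
  have hne' (x : Fin n → SignType) (hx : ¬ (support x).card ≤ 2 * r - 2) :
      minColor r k c (posPart x) ≠ minColor r k c (posPart (-x)) := by
    rcases min_lt_iff.1 (hlt x hx) with h | h
    · exact hdis _ _ (disjoint_posPart_neg x) h
    · exact (hdis _ _ (disjoint_posPart_neg x).symm h).symm
  -- Small supports use absolute values below `2r - 2` and large ones the values from there on, so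
  -- only like cases can clash. Equal small sizes force `x = y`. For large supports, opposite labels
  -- would give equal least colours on opposite, hence disjoint, parts of `x` and `y`.
  have hT : IsTuckerLabelling (kneserLabel r k c) := by
    constructor
    · intro x hx
      unfold kneserLabel
      rw [support_neg, neg_neg]
      split_ifs with h
      · rw [flipLabel_mkLabel, mkLabel_inj]
        refine ⟨rfl, ?_⟩
        classical
        by_cases hL : LeadPos x
        · rw [decide_eq_false (mt (leadPos_neg hx).1 (not_not.2 hL)), decide_eq_true hL, Bool.not_true]
        · rw [decide_eq_true ((leadPos_neg hx).2 hL), decide_eq_false hL, Bool.not_false]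
      · rw [flipLabel_mkLabel, mkLabel_inj, min_comm]
        refine ⟨rfl, ?_⟩
        have := hne' x h
        rw [← decide_not, decide_eq_decide]
        omega
    · intro x y hx hxy he
      have hs : support x ⊆ support y := fun i hi => by
        rw [mem_support] at *
        rwa [hxy i hi]
      have hxs := (support_nonempty hx).card_pos
      have hcard := Finset.card_le_card hs
      unfold kneserLabel at he
      split_ifs at he with h1 h2 h2
      · rw [flipLabel_mkLabel, mkLabel_inj] at he
        obtain rfl := eq_of_card_support_eq hxy (by omega)
        simpa using he.2
      · rw [flipLabel_mkLabel, mkLabel_inj] at he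
        omega
      · omega
      · rw [flipLabel_mkLabel, mkLabel_inj, ← decide_not, decide_eq_decide] at he
        have hp := posPart_mono hxy
        have hq := posPart_mono (x := -x) (y := -y) (fun i hi => by
          simp only [Pi.neg_apply] at *
          rw [hxy i (fun h0 => hi (by rw [h0]; decide))])
        have hd := disjoint_posPart_neg y
        have hx1 := hlt x h1
        have hx2 := hne' x h1
        have hy2 := hne' y h2
        rcases lt_or_gt_of_ne hx2 with h | h
        · exact hdis _ _ (Finset.disjoint_of_subset_left hp hd) (by omega)
            (by omega : _ = minColor r k c (posPart (-y)))
        · exact hdis _ _ (Finset.disjoint_of_subset_left hq hd.symm) (by omega)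
            (by omega : _ = minColor r k c (posPart y))
  have := hT.dim_le (m := 2 * r - 2 + k) (fun x hx => by
    have hxs := (support_nonempty hx).card_pos
    unfold kneserLabel
    split_ifs with h
    · rw [mkLabel_div_two]
      have := hlt
      by_cases hk : k = 0
      · have := hc ∅
        omega
      · omega
    · rw [mkLabel_div_two]
      have := hlt x h
      omega)
  omega

/-! ### Half-integral approximation along an infinite set -/

theorem Set.Infinite.exists_natAbs_gt {E : Set ℤ} (hE : E.Infinite) (N : ℕ) :
    ∃ e ∈ E, N < e.natAbs := by
  obtain ⟨e, he, he'⟩ := hE.exists_notMem_finite (Set.finite_Icc (-(N : ℤ)) N)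
  refine ⟨e, he, ?_⟩
  rw [Set.mem_Icc] at he'
  omega

/-- In an infinite set of integers one finds elements `e F` and a rational point `α` of a torus such
that each `e F • α` is close to half the indicator vector of `F`. -/
theorem exists_approx_half_indicator {n : ℕ} {E : Set ℤ} (hE : E.Infinite) {δ : ℚ} (hδ : 0 < δ)
    (S : Finset (Finset (Fin n))) :
    ∃ (e : Finset (Fin n) → ℤ) (α : Fin n → ℚ), ∀ F ∈ S, e F ∈ E ∧
      ∀ i, ∃ z : ℤ, |e F * α i - (if i ∈ F then 1 / 2 else 0) - z| < δ := by
  induction S using Finset.induction_on with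
  | empty => exact ⟨0, 0, by simp⟩
  | insert F₀ S hF₀ ih =>
    obtain ⟨e, α, h⟩ := ih
    -- The conditions already secured are open in the torus point, so `α` may be moved slightly.
    have hev : ∀ᶠ β : Fin n → ℚ in nhds α, ∀ F ∈ S, ∀ i, ∃ z : ℤ,
        |e F * β i - (if i ∈ F then 1 / 2 else 0) - z| < δ := by
      rw [Filter.eventually_all_finset]
      intro F hF
      rw [Filter.eventually_all]
      intro i
      obtain ⟨z, hz⟩ := (h F hF).2 i
      have hcont : Continuous fun β : Fin n → ℚ =>
          |e F * β i - (if i ∈ F then 1 / 2 else 0) - z| := by fun_prop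
      exact (hcont.continuousAt.eventually_lt_const hz).mono fun β hβ => ⟨z, hβ⟩
    obtain ⟨η, hη, hball⟩ := Metric.eventually_nhds_iff.1 hev
    obtain ⟨N, hN⟩ := exists_nat_gt (1 / η)
    obtain ⟨e₀, he₀, he₀N⟩ := hE.exists_natAbs_gt N
    set t : Fin n → ℚ := fun i => if i ∈ F₀ then 1 / 2 else 0 with ht
    have hpos : 0 < |(e₀ : ℚ)| := by
      rw [abs_pos, Int.cast_ne_zero]
      omega
    have hne : (e₀ : ℚ) ≠ 0 := abs_pos.1 hpos
    -- A point near `α` for which `e₀ β` equals the target exactly mod 1. It moves each coordinate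
    -- by at most `1 / (2|e₀|)`, below `η` by the choice of `N`.
    set β : Fin n → ℚ := fun i => (round (e₀ * α i - t i) + t i) / e₀ with hβ
    have hdist : dist β α < η := by
      rw [dist_pi_lt_iff hη]
      intro i
      have h1 : β i - α i = -((e₀ * α i - t i) - round (e₀ * α i - t i)) / e₀ := by
        rw [hβ]; field_simp; ring
      have h2 : |β i - α i| ≤ 1 / 2 / |(e₀ : ℚ)| := by
        rw [h1, abs_div, abs_neg]
        gcongr
        exact abs_sub_round _
      have h3 : (1 : ℝ) / 2 / |(e₀ : ℝ)| < η := by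
        have h4 : (N : ℝ) < |(e₀ : ℝ)| := by
          rw [← Int.cast_abs, Int.abs_eq_natAbs]
          exact_mod_cast he₀N
        rw [div_lt_iff₀ hη] at hN
        rw [div_lt_iff₀ (by exact_mod_cast hpos)]
        nlinarith
      rw [Rat.dist_eq]
      refine lt_of_le_of_lt ?_ h3
      have h5 := (Rat.cast_le (K := ℝ)).2 h2
      push_cast at h5
      exact h5
    refine ⟨Function.update e F₀ e₀, β, fun F hF => ?_⟩
    by_cases hFF : F = F₀
    · subst hFF
      rw [Function.update_self]
      refine ⟨he₀, fun i => ⟨round (e₀ * α i - t i), ?_⟩⟩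
      have : (e₀ : ℚ) * β i - (if i ∈ F then 1 / 2 else 0) - round (e₀ * α i - t i) = 0 := by
        rw [hβ]; simp only [ht]; field_simp; ring
      rwa [this, abs_zero]
    · rw [Function.update_of_ne hFF]
      have hFS := Finset.mem_of_mem_insert_of_ne hF hFF
      exact ⟨(h F hFS).1, hball hdist F hFS⟩

/-! ### The upper half of the cube -/

/-- The factor `2n + 1` lets the induction close through `(2n + 1)(2n + 3) ≤ 4(n + 1)²`, and yields
`centralBinom n / 4 ^ n = O(n ^ (-1/2))`. -/
theorem centralBinom_sq_mul_le (n : ℕ) : n.centralBinom ^ 2 * (2 * n + 1) ≤ 16 ^ n := by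
  induction n with
  | zero => simp
  | succ n ih =>
    have h := Nat.succ_mul_centralBinom_succ n
    have h2 : (n + 1) ^ 2 * ((n + 1).centralBinom ^ 2 * (2 * (n + 1) + 1)) =
        4 * ((2 * n + 1) * (2 * n + 3)) * (n.centralBinom ^ 2 * (2 * n + 1)) := by
      calc _ = ((n + 1) * (n + 1).centralBinom) ^ 2 * (2 * (n + 1) + 1) := by ring
        _ = _ := by rw [h]; ring
    have h3 : (n + 1) ^ 2 * ((n + 1).centralBinom ^ 2 * (2 * (n + 1) + 1)) ≤
        (n + 1) ^ 2 * 16 ^ (n + 1) := by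
      rw [h2]
      calc _ ≤ 4 * (4 * (n + 1) ^ 2) * 16 ^ n :=
            Nat.mul_le_mul (Nat.mul_le_mul_left 4 (by nlinarith)) ih
        _ = _ := by ring
    exact Nat.le_of_mul_le_mul_left h3 (by positivity)

theorem tendsto_centralBinom_div :
    Filter.Tendsto (fun n : ℕ => (n.centralBinom : ℝ) / 4 ^ n) Filter.atTop (nhds 0) := by
  have h1 : Filter.Tendsto (fun n : ℕ => Real.sqrt (1 / ((n : ℝ) + 1))) Filter.atTop (nhds 0) := by
    simpa using (tendsto_one_div_add_atTop_nhds_zero_nat (𝕜 := ℝ)).sqrt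
  refine squeeze_zero (fun n => by positivity) (fun n => ?_) h1
  apply Real.le_sqrt_of_sq_le
  rw [div_pow, div_le_div_iff₀ (by positivity) (by positivity), one_mul, ← pow_mul, mul_comm n 2,
    pow_mul]
  have h := centralBinom_sq_mul_le n
  have h' : (n.centralBinom : ℝ) ^ 2 * (2 * n + 1) ≤ 16 ^ n := by exact_mod_cast h
  norm_num
  nlinarith [sq_nonneg (n.centralBinom : ℝ), mul_nonneg (sq_nonneg (n.centralBinom : ℝ)) (Nat.cast_nonneg (α := ℝ) n)]

/-- About half of the subsets of a `2M`-element set have at least `M + k + 1` elements. -/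
theorem four_pow_le_card_upper_half (M k : ℕ) :
    4 ^ M ≤ 2 * ((Finset.univ : Finset (Finset (Fin (2 * M)))).filter
      fun J => M + k + 1 ≤ J.card).card + (2 * k + 1) * M.centralBinom := by
  set U := (Finset.univ : Finset (Finset (Fin (2 * M)))).filter fun J => M + k + 1 ≤ J.card
  -- Complementation matches `D` with `U`; only the `2k + 1` middle layers remain, each of size at
  -- most the central binomial coefficient.
  set D := (Finset.univ : Finset (Finset (Fin (2 * M)))).filter fun J => J.card + k + 1 ≤ M
  have hDU : D.card = U.card := by
    refine Finset.card_bij' (fun J _ => Jᶜ) (fun J _ => Jᶜ) ?_ ?_ (by simp) (by simp)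
    all_goals
      intro J hJ
      have h1 := Finset.card_compl J
      have h2 := Finset.card_le_univ J
      rw [Fintype.card_fin] at h1 h2
      simp only [U, D, Finset.mem_filter, Finset.mem_univ, true_and] at hJ ⊢
      omega
  have hcover : (Finset.univ : Finset (Finset (Fin (2 * M)))) ⊆ (U ∪ D) ∪
      (Finset.Icc (M - k) (M + k)).biUnion fun j => Finset.powersetCard j Finset.univ := by
    intro J _
    simp only [U, D, Finset.mem_union, Finset.mem_filter, Finset.mem_univ, true_and,
      Finset.mem_biUnion, Finset.mem_Icc, Finset.mem_powersetCard, Finset.subset_univ]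
    by_cases h1 : M + k + 1 ≤ J.card
    · exact Or.inl (Or.inl h1)
    · by_cases h2 : J.card + k + 1 ≤ M
      · exact Or.inl (Or.inr h2)
      · exact Or.inr ⟨J.card, by omega, rfl⟩
  have h1 := (Finset.card_le_card hcover).trans (Finset.card_union_le _ _)
  have h2 := Finset.card_union_le U D
  have h3 : ((Finset.Icc (M - k) (M + k)).biUnion fun j =>
      Finset.powersetCard j (Finset.univ : Finset (Fin (2 * M)))).card ≤
      (2 * k + 1) * M.centralBinom := by
    refine (Finset.card_biUnion_le_card_mul _ _ M.centralBinom fun j _ => ?_).trans ?_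
    · rw [Finset.card_powersetCard, Finset.card_univ, Fintype.card_fin]
      exact Nat.choose_le_centralBinom j M
    · gcongr
      rw [Nat.card_Icc]
      omega
  have h4 : (Finset.univ : Finset (Finset (Fin (2 * M)))).card = 4 ^ M := by
    rw [Finset.card_univ, Fintype.card_finset, Fintype.card_fin, pow_mul]
    norm_num
  omega

/-! ### Dense periodic sets of integers -/

open Classical in
theorem mul_card_le_card_of_periodic {A : Set ℤ} {q : ℕ} (hA : ∀ N ∈ A, N + q ∈ A) (l : ℕ) :
    l * ((Finset.Icc (1 : ℤ) q).filter (· ∈ A)).card ≤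
      ((Finset.Icc (1 : ℤ) (q * l : ℕ)).filter (· ∈ A)).card := by
  have hA' (l : ℕ) : ∀ N ∈ A, N + (q * l : ℕ) ∈ A := by
    induction l with
    | zero => simp
    | succ l ih =>
      intro N hN
      have := hA _ (ih N hN)
      rwa [add_assoc, ← Nat.cast_add, ← Nat.mul_succ] at this
  induction l with
  | zero => simp
  | succ l ih =>
    set B := (Finset.Icc (1 : ℤ) q).filter (· ∈ A)
    have hd : Disjoint ((Finset.Icc (1 : ℤ) (q * l : ℕ)).filter (· ∈ A))
        (B.map (addRightEmbedding ((q * l : ℕ) : ℤ))) := by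
      rw [Finset.disjoint_left]
      intro N h1 h2
      simp only [B, Finset.mem_map, Finset.mem_filter, Finset.mem_Icc, addRightEmbedding_apply] at h1 h2
      obtain ⟨m, hm, rfl⟩ := h2
      omega
    calc (l + 1) * B.card ≤ ((Finset.Icc (1 : ℤ) (q * l : ℕ)).filter (· ∈ A)).card +
          (B.map (addRightEmbedding ((q * l : ℕ) : ℤ))).card := by
            rw [Finset.card_map]; linarith
      _ = _ := (Finset.card_union_of_disjoint hd).symm
      _ ≤ _ := by
        refine Finset.card_le_card fun N hN => ?_
        simp only [B, Finset.mem_union, Finset.mem_map, Finset.mem_filter, Finset.mem_Icc,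
          addRightEmbedding_apply] at hN ⊢
        rw [Nat.mul_succ]
        have hql : (0 : ℤ) ≤ q * l := by positivity
        rcases hN with h | ⟨m, hm, rfl⟩
        · exact ⟨by push_cast at *; omega, h.2⟩
        · exact ⟨by push_cast at *; omega, hA' l m hm.2⟩

open Classical in
theorem le_upperDensity_of_periodic {A : Set ℤ} {q : ℕ} (hq : 0 < q) (hA : ∀ N ∈ A, N + q ∈ A) :
    (((Finset.Icc (1 : ℤ) q).filter (· ∈ A)).card : ℝ) / q ≤ upperDensity A := by
  have hcard (n : ℕ) : (A ∩ Set.Icc 1 (n : ℤ)).ncard =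
      ((Finset.Icc (1 : ℤ) n).filter (· ∈ A)).card := by
    rw [← Set.ncard_coe_finset]
    congr 1
    ext N
    simp only [Set.mem_inter_iff, Set.mem_Icc, Finset.coe_filter, Finset.mem_Icc, Set.mem_ofPred_eq]
    tauto
  refine Filter.le_limsup_of_frequently_le ?_ ?_
  · rw [Filter.frequently_atTop]
    intro N
    refine ⟨q * (N + 1), by nlinarith, ?_⟩
    rw [hcard, div_le_div_iff₀ (by positivity) (by positivity)]
    have := mul_card_le_card_of_periodic hA (N + 1)
    have h2 : ((N + 1 : ℕ) * ((Finset.Icc (1 : ℤ) q).filter (· ∈ A)).card : ℝ) ≤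
      ((Finset.Icc (1 : ℤ) (q * (N + 1) : ℕ)).filter (· ∈ A)).card := by exact_mod_cast this
    have h3 : (0 : ℝ) ≤ q := by positivity
    have := mul_le_mul_of_nonneg_right h2 h3
    push_cast at this ⊢
    linarith
  · refine Filter.isBoundedUnder_of ⟨1, fun n => ?_⟩
    rw [hcard]
    refine div_le_one_of_le₀ ?_ (Nat.cast_nonneg n)
    have := Finset.card_filter_le (Finset.Icc (1 : ℤ) n) (· ∈ A)
    rw [Int.card_Icc] at this
    exact_mod_cast (by omega : _ ≤ n)

open Classical in
/-- Averaging over translates: some translate of a cyclic orbit in a finite group visits `U` at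
least as often as the density of `U` predicts. -/
theorem exists_translate_visits {G : Type*} [AddCommGroup G] [Fintype G] (U : Finset G) (a : G)
    (I : Finset ℤ) : ∃ x : G, I.card * U.card ≤
      (I.filter fun N => x + N • a ∈ U).card * Fintype.card G := by
  by_contra! h
  have h1 : ∑ x : G, (I.filter fun N => x + N • a ∈ U).card = I.card * U.card := by
    simp only [Finset.card_filter]
    rw [Finset.sum_comm]
    have (N : ℤ) : ∑ x : G, (if x + N • a ∈ U then 1 else 0) = U.card := by
      have h2 : ∑ x : G, (if x + N • a ∈ U then 1 else 0) = ∑ y : G, if y ∈ U then 1 else 0 :=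
        Fintype.sum_equiv (Equiv.addRight (N • a)) _ _ fun x => rfl
      rw [h2]
      simp
    simp [this]
  have h2 := Finset.sum_lt_sum_of_nonempty Finset.univ_nonempty fun x (_ : x ∈ Finset.univ) => h x
  rw [← Finset.sum_mul, h1, Finset.sum_const, Finset.card_univ, smul_eq_mul] at h2
  exact absurd h2 (by rw [mul_comm]; exact lt_irrefl _)

/-- The points with at least `l` coordinates in `[0, h)`. -/
def manySmall (n q h l : ℕ) [NeZero q] : Finset (Fin n → ZMod q) :=
  Finset.univ.filter fun y => l ≤ (Finset.univ.filter fun i => (y i).val < h).card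

/-- Only points with all coordinates in `[0, 2h)` are counted: choose the set `J` of coordinates
below `h`, then an offset in `[0, h)` for every coordinate. -/
theorem card_manySmall_ge (n q h l : ℕ) [NeZero q] (hq : 2 * h ≤ q) :
    ((Finset.univ : Finset (Finset (Fin n))).filter fun J => l ≤ J.card).card * h ^ n ≤
      (manySmall n q h l).card := by
  have hval (J : Finset (Fin n)) (v : Fin n → Fin h) (i : Fin n) :
      (((if i ∈ J then (v i : ℕ) else v i + h : ℕ) : ZMod q)).val =
        if i ∈ J then (v i : ℕ) else v i + h := by
    apply ZMod.val_cast_of_lt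
    have := (v i).2
    split_ifs <;> omega
  have hlt (J : Finset (Fin n)) (v : Fin n → Fin h) (i : Fin n) :
      (((if i ∈ J then (v i : ℕ) else v i + h : ℕ) : ZMod q)).val < h ↔ i ∈ J := by
    rw [hval]
    have := (v i).2
    split_ifs with hi <;> simp [hi]
  have hcard : (((Finset.univ : Finset (Finset (Fin n))).filter fun J => l ≤ J.card) ×ˢ
      (Finset.univ : Finset (Fin n → Fin h))).card =
      ((Finset.univ : Finset (Finset (Fin n))).filter fun J => l ≤ J.card).card * h ^ n := by
    simp [Finset.card_product]
  rw [← hcard]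
  refine Finset.card_le_card_of_injOn
    (fun p i => ((if i ∈ p.1 then (p.2 i : ℕ) else p.2 i + h : ℕ) : ZMod q)) ?_ ?_
  · rintro ⟨J, v⟩ hJ
    simp only [Finset.coe_product, Set.mem_prod, Finset.mem_coe, Finset.mem_filter,
      Finset.mem_univ, true_and, and_true] at hJ
    simp only [manySmall, Finset.mem_coe, Finset.mem_filter, Finset.mem_univ, true_and, hlt]
    simpa using hJ
  · rintro ⟨J, v⟩ - ⟨J', v'⟩ - he
    have he' (i : Fin n) := congrArg ZMod.val (congrFun he i)
    simp only [hval] at he'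
    have hJ : J = J' := by
      ext i
      rw [← hlt J v, ← hlt J' v', hval, hval, he']
    subst hJ
    refine Prod.ext rfl (funext fun i => Fin.ext ?_)
    have := he' i
    simp only at this ⊢
    split_ifs at this <;> omega

/-- A dense set of integers whose differences `d` cannot have too many multiples `d * a i` close to
the middle `w * u` modulo `2 * w * u`. -/
theorem exists_dense_avoiding (n l w u : ℕ) (hw : 1 ≤ w) (hu : 1 ≤ u) (a : Fin n → ℤ) :
    ∃ A : Set ℤ,
      (((Finset.univ : Finset (Finset (Fin n))).filter fun J => l ≤ J.card).card : ℝ) *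
        (((w - 1) * u) ^ n / (2 * w * u) ^ n) ≤ upperDensity A ∧
      ∀ d ∈ A - A, ∀ T : Finset (Fin n),
        (∀ i ∈ T, ∃ z : ℤ, |d * a i - w * u - 2 * w * u * z| < u) → 2 * l ≤ n + Tᶜ.card := by
  classical
  set q := 2 * w * u with hq
  -- The window falls short of `q / 2 = w * u` by `u`, exactly the tolerance in the condition on
  -- `T`.
  set h := (w - 1) * u with hh
  have hq0 : 0 < q := by positivity
  have : NeZero q := ⟨hq0.ne'⟩
  have hhq : 2 * h ≤ q := by
    rw [hq, hh, mul_assoc]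
    exact Nat.mul_le_mul_left 2 (Nat.mul_le_mul_right u (Nat.sub_le w 1))
  have hhz : (h : ℤ) = (w - 1) * u := by rw [hh]; push_cast [hw]; ring
  obtain ⟨b, hb⟩ : ∃ b : Fin n → ZMod q, ∀ i, b i = a i := ⟨_, fun _ => rfl⟩
  obtain ⟨x, hx⟩ := exists_translate_visits (manySmall n q h l) b (Finset.Icc (1 : ℤ) q)
  obtain ⟨A, hA⟩ : ∃ A : Set ℤ, ∀ N, N ∈ A ↔ x + N • b ∈ manySmall n q h l :=
    ⟨{N | x + N • b ∈ manySmall n q h l}, fun _ => Iff.rfl⟩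
  simp only [← hA] at hx
  refine ⟨A, ?_, ?_⟩
  · refine le_trans ?_ (le_upperDensity_of_periodic hq0 (A := A) fun N hN => ?_)
    · have h1 := card_manySmall_ge n q h l hhq
      rw [Int.card_Icc, Fintype.card_fun, ZMod.card, Fintype.card_fin] at hx
      have h2 : q * (((Finset.univ : Finset (Finset (Fin n))).filter fun J => l ≤ J.card).card *
          h ^ n) ≤ ((Finset.Icc (1 : ℤ) q).filter (· ∈ A)).card * q ^ n := by
        refine (Nat.mul_le_mul_left q h1).trans ?_
        simpa using hx
      have h3 : (q : ℝ) * (((Finset.univ : Finset (Finset (Fin n))).filter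
          fun J => l ≤ J.card).card * (h : ℝ) ^ n) ≤
          ((Finset.Icc (1 : ℤ) q).filter (· ∈ A)).card * (q : ℝ) ^ n := by exact_mod_cast h2
      have h4 : ((w : ℝ) - 1) * u = h := by rw [hh]; push_cast [hw]; ring
      have h5 : (2 : ℝ) * w * u = q := by rw [hq]; push_cast; ring
      have hq' : (0 : ℝ) < q := by exact_mod_cast hq0
      rw [h4, h5, ← mul_div_assoc, div_le_div_iff₀ (by positivity) (by positivity)]
      linarith only [h3]
    · have : (N + q) • b = N • b := by
        ext i
        rw [add_smul, Pi.add_apply, Pi.smul_apply (q : ℤ), zsmul_eq_mul]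
        simp
      rwa [hA, this, ← hA]
  · rintro d ⟨N₁, hN₁, N₂, hN₂, rfl⟩ T hT
    simp only at hT
    simp only [hA, manySmall, Finset.mem_filter, Finset.mem_univ,
      true_and] at hN₁ hN₂
    set J₁ := Finset.univ.filter fun i => ((x + N₁ • b) i).val < h with hJ₁
    set J₂ := Finset.univ.filter fun i => ((x + N₂ • b) i).val < h with hJ₂
    -- Two residues in `[0, h)` differ by less than `(w - 1) * u`, so their difference cannot be
    -- within `u` of `w * u` mod `q`.
    have hsub : J₁ ∩ J₂ ⊆ Tᶜ := by
      intro i hi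
      rw [Finset.mem_compl]
      intro hiT
      obtain ⟨z, hz⟩ := hT i hiT
      simp only [hJ₁, hJ₂, Finset.mem_inter, Finset.mem_filter, Finset.mem_univ, true_and] at hi
      set y₁ := (x + N₁ • b) i with hy₁
      set y₂ := (x + N₂ • b) i with hy₂
      have hdvd : (q : ℤ) ∣ (y₁.val - y₂.val) - (N₁ - N₂) * a i := by
        rw [← ZMod.intCast_zmod_eq_zero_iff_dvd]
        push_cast
        rw [ZMod.natCast_zmod_val, ZMod.natCast_zmod_val, hy₁, hy₂]
        simp only [Pi.add_apply, Pi.smul_apply]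
        simp only [zsmul_eq_mul, hb]
        ring
      obtain ⟨t, ht⟩ := hdvd
      have h1 : (y₁.val : ℤ) < h := by exact_mod_cast hi.1
      have h2 : (y₂.val : ℤ) < h := by exact_mod_cast hi.2
      rw [hhz] at h1 h2
      have hqz : (q : ℤ) = 2 * w * u := by rw [hq]; push_cast; ring
      rw [hqz] at ht
      rw [abs_lt] at hz
      have hwu : (0 : ℤ) ≤ w * u := by positivity
      have hy1 : (0 : ℤ) ≤ y₁.val := by positivity
      have hy2 : (0 : ℤ) ≤ y₂.val := by positivity
      rcases le_or_gt 0 (z + t) with hzt | hzt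
      · have := mul_nonneg hwu hzt
        linarith only [this, ht, hz.1, h1, hy2]
      · have := mul_nonneg hwu (by omega : 0 ≤ -(z + t + 1))
        linarith only [this, ht, hz.2, h2, hy1]
    have h1 := Finset.card_union_add_card_inter J₁ J₂
    have h2 := Finset.card_le_card hsub
    have h3 := Finset.card_le_univ (J₁ ∪ J₂)
    rw [Fintype.card_fin] at h3
    omega

theorem exists_upper_half_dense (k : ℕ) {δ : ℝ} (hδ : δ < 1 / 2) : ∃ M w : ℕ, k + 1 ≤ M ∧ 1 ≤ w ∧
    ∀ u : ℕ, 1 ≤ u → δ < (((Finset.univ : Finset (Finset (Fin (2 * M)))).filter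
      fun J => M + k + 1 ≤ J.card).card : ℝ) *
        (((w - 1) * u) ^ (2 * M) / (2 * w * u) ^ (2 * M)) := by
  have h1 : Filter.Tendsto (fun M : ℕ => (2 * (k : ℝ) + 1) * ((M.centralBinom : ℝ) / 4 ^ M))
      Filter.atTop (nhds 0) := by
    simpa using tendsto_centralBinom_div.const_mul (2 * (k : ℝ) + 1)
  -- First `M` makes the upper half of the cube dense enough; then, for this fixed `M`, a large `w`
  -- brings the loss `(1 - 1/w) ^ (2M)` close to 1. The scale `u` cancels.
  obtain ⟨M, hM1, hM2⟩ := ((h1.eventually_lt_const (by linarith : (0 : ℝ) < 1 - 2 * δ)).and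
    (Filter.eventually_ge_atTop (k + 1))).exists
  set p := ((Finset.univ : Finset (Finset (Fin (2 * M)))).filter
      fun J => M + k + 1 ≤ J.card).card with hp
  have h2 : (4 : ℝ) ^ M ≤ 2 * p + (2 * k + 1) * M.centralBinom := by
    exact_mod_cast four_pow_le_card_upper_half M k
  have h4 : (0 : ℝ) < 4 ^ M := by positivity
  have h3 : δ < p / 4 ^ M := by
    rw [lt_div_iff₀ h4]
    rw [← mul_div_assoc, div_lt_iff₀ h4] at hM1
    linarith
  have h5 : Filter.Tendsto (fun w : ℕ => (p / 4 ^ M : ℝ) * (1 - 1 / (w : ℝ)) ^ (2 * M))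
      Filter.atTop (nhds (p / 4 ^ M)) := by
    simpa using ((tendsto_one_div_atTop_nhds_zero_nat (𝕜 := ℝ)).const_sub 1 |>.pow
      (2 * M)).const_mul (p / 4 ^ M : ℝ)
  obtain ⟨w, hw1, hw2⟩ := ((h5.eventually_const_lt h3).and (Filter.eventually_ge_atTop 1)).exists
  refine ⟨M, w, hM2, hw2, fun u hu => hw1.trans_eq ?_⟩
  have hw0 : (w : ℝ) ≠ 0 := by positivity
  have hu0 : (u : ℝ) ≠ 0 := by positivity
  have h6 : (4 : ℝ) ^ M = 2 ^ (2 * M) := by rw [pow_mul]; norm_num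
  rw [h6, div_mul_eq_mul_div, mul_div_assoc, ← div_pow, ← div_pow]
  congr 2
  field_simp

/-! ### Assembling the Kneser differences -/

/-- An infinite set contains a family of integers indexed by finite sets whose differences
`e F - e G`, for disjoint `F` and `G`, have multiples near the middle modulo `2 * w * u` at all
coordinates in `F ∪ G`. -/
theorem exists_family_near_middle {E : Set ℤ} (hE : E.Infinite) (n : ℕ) {w : ℕ} (hw : 1 ≤ w) :
    ∃ (e : Finset (Fin n) → ℤ) (u : ℕ) (a : Fin n → ℤ), 1 ≤ u ∧ (∀ F, e F ∈ E) ∧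
      ∀ F G, Disjoint F G → ∀ i ∈ F ∪ G,
        ∃ z : ℤ, |(e F - e G) * a i - w * u - 2 * w * u * z| < u := by
  have hw0 : (0 : ℚ) < w := by exact_mod_cast hw
  -- Two errors below `1 / (4w)` add up to less than `1 / (2w)`, which becomes `u` after scaling by
  -- `2 * w * u`.
  obtain ⟨e, α, h⟩ := exists_approx_half_indicator (n := n) hE
    (by positivity : (0 : ℚ) < 1 / (4 * w)) Finset.univ
  set u := ∏ i, (α i).den with hu
  have hu1 : 1 ≤ u := Finset.prod_pos fun i _ => (α i).den_pos
  have hu0 : (0 : ℚ) < u := by exact_mod_cast hu1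
  have hc (i : Fin n) : ∃ c : ℤ, α i * u = c := by
    obtain ⟨t, ht⟩ : (α i).den ∣ u := Finset.dvd_prod_of_mem _ (Finset.mem_univ i)
    refine ⟨(α i).num * t, ?_⟩
    rw [ht]
    push_cast
    rw [← mul_assoc, Rat.mul_den_eq_num]
  choose c hc using hc
  refine ⟨e, u, fun i => 2 * w * c i, hu1, fun F => (h F (Finset.mem_univ F)).1, ?_⟩
  intro F G hFG i hi
  obtain ⟨z₁, h₁⟩ := (h F (Finset.mem_univ F)).2 i
  obtain ⟨z₂, h₂⟩ := (h G (Finset.mem_univ G)).2 i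
  have key : ∀ z : ℤ, |((e F : ℚ) - e G) * α i - 1 / 2 - z| < 1 / (2 * w) →
      |(e F - e G) * (2 * w * c i) - w * u - 2 * w * u * z| < (u : ℤ) := by
    intro z hz
    have h3 : ((|(e F - e G) * (2 * w * c i) - w * u - 2 * w * u * z| : ℤ) : ℚ) =
        |((e F : ℚ) - e G) * α i - 1 / 2 - z| * (2 * w * u) := by
      rw [← abs_of_pos (by positivity : (0 : ℚ) < 2 * w * u), ← abs_mul]
      push_cast
      rw [← hc]
      congr 1
      ring
    have h4 := mul_lt_mul_of_pos_right hz (by positivity : (0 : ℚ) < 2 * w * u)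
    rw [← h3] at h4
    have h5 : 1 / (2 * (w : ℚ)) * (2 * w * u) = u := by field_simp
    rw [h5] at h4
    exact_mod_cast h4
  have h6 : (1 : ℚ) / (2 * w) = 1 / (4 * w) + 1 / (4 * w) := by field_simp; norm_num
  rcases Finset.mem_union.1 hi with hiF | hiG
  · have hiG := Finset.disjoint_left.1 hFG hiF
    rw [if_pos hiF, abs_lt] at h₁
    rw [if_neg hiG, abs_lt] at h₂
    refine ⟨z₁ - z₂, key _ ?_⟩
    push_cast
    rw [h6, abs_lt]
    constructor <;> linarith
  · have hiF := Finset.disjoint_right.1 hFG hiG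
    rw [if_neg hiF, abs_lt] at h₁
    rw [if_pos hiG, abs_lt] at h₂
    -- For `i ∈ G` the difference is near `-1/2`, and the extra `-1` moves it to `1/2`.
    refine ⟨z₁ - z₂ - 1, key _ ?_⟩
    push_cast
    rw [h6, abs_lt]
    constructor <;> linarith

theorem exists_nonrecurrent_chromatic (k : ℕ) {δ : ℝ} (hδ : δ < 1 / 2) {E : Set ℤ}
    (hE : E.Infinite) : ∃ S : Set ℤ, S.Finite ∧ (∀ n ∈ S, 0 < n) ∧ DeltaNonrecurrent δ S ∧
      S ⊆ E - E ∧ ∀ f : ℤ → ℕ, (∀ x, f x < k) → ∃ x y, f x = f y ∧ x - y ∈ S := by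
  obtain ⟨M, w, hM, hw, hdense⟩ := exists_upper_half_dense k hδ
  obtain ⟨e, u, a, hu, heE, hmid⟩ := exists_family_near_middle hE (2 * M) hw
  have hcompl (F G : Finset (Fin (2 * M))) (hF : F.card = M - k) (hG : G.card = M - k)
      (hFG : Disjoint F G) : ((F ∪ G)ᶜ).card = 2 * k := by
    rw [Finset.card_compl, Finset.card_union_of_disjoint hFG, Fintype.card_fin]
    omega
  set S : Set ℤ := {x | 0 < x ∧ ∃ F G : Finset (Fin (2 * M)), F.card = M - k ∧ G.card = M - k ∧
    Disjoint F G ∧ e F - e G = x} with hS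
  refine ⟨S, ?_, fun n hn => hn.1, ?_, ?_, ?_⟩
  · refine (Set.finite_range fun p : Finset (Fin (2 * M)) × Finset (Fin (2 * M)) =>
      e p.1 - e p.2).subset ?_
    rintro x ⟨-, F, G, -, -, -, rfl⟩
    exact ⟨(F, G), rfl⟩
  · obtain ⟨A, hA, hAd⟩ := exists_dense_avoiding (2 * M) (M + k + 1) w u hw hu a
    refine ⟨A, (hdense u hu).trans_le hA, ?_⟩
    rw [Set.eq_empty_iff_forall_notMem]
    rintro x ⟨hx, -, F, G, hF, hG, hFG, rfl⟩
    -- This would give `2(M + k + 1) ≤ 2M + 2k`.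
    have := hAd _ hx (F ∪ G) (hmid F G hFG)
    rw [hcompl F G hF hG hFG] at this
    omega
  · rintro x ⟨-, F, G, -, -, -, rfl⟩
    exact Set.sub_mem_sub (heE F) (heE G)
  · intro f hf
    obtain ⟨F, G, hF, hG, hFG, hc⟩ := exists_disjoint_color_eq (n := 2 * M) (r := M - k) (k := k)
      (by omega) (by omega) (fun G => f (e G)) fun G => hf _
    -- Zero is not within `u` of `w * u` mod `2 * w * u`. Hence the difference is nonzero and, after
    -- possibly swapping `F` and `G`, positive.
    have hne : e F ≠ e G := by
      intro he
      obtain ⟨i, hi⟩ := Finset.card_pos.1 (by omega : 0 < F.card)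
      obtain ⟨z, hz⟩ := hmid F G hFG i (Finset.mem_union_left _ hi)
      have hw' : (1 : ℤ) ≤ w := by exact_mod_cast hw
      have hu' : (1 : ℤ) ≤ u := by exact_mod_cast hu
      have hwu : (u : ℤ) ≤ w * u := by nlinarith
      rw [he, sub_self, zero_mul, abs_lt] at hz
      rcases le_or_gt 0 z with h | h
      · have := mul_nonneg (by positivity : (0 : ℤ) ≤ w * u) h
        linarith only [this, hz.1, hwu]
      · have := mul_nonneg (by positivity : (0 : ℤ) ≤ w * u) (by omega : 0 ≤ -(z + 1))
        linarith only [this, hz.2, hwu]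
    rcases lt_or_gt_of_ne hne with h | h
    · exact ⟨e G, e F, hc.symm, sub_pos.2 h, G, F, hG, hF, hFG.symm, rfl⟩
    · exact ⟨e F, e G, hc, sub_pos.2 h, F, G, hF, hG, hFG, rfl⟩

theorem Set.Infinite.exists_infinite_residue {E : Set ℤ} (hE : E.Infinite) {m : ℕ} (hm : 1 ≤ m) :
    ∃ r : ℤ, {e : ℤ | r + m * e ∈ E}.Infinite := by
  by_contra! h
  refine hE ?_
  have hsub : E ⊆ ⋃ r ∈ Finset.Ico (0 : ℤ) m, (fun e => r + m * e) '' {e : ℤ | r + m * e ∈ E} := by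
    intro x hx
    have hm' : (0 : ℤ) < m := by exact_mod_cast hm
    simp only [Set.mem_iUnion, Finset.mem_Ico]
    refine ⟨x % m, ⟨Int.emod_nonneg x hm'.ne', Int.emod_lt_of_pos x hm'⟩, x / m, ?_,
      Int.emod_add_mul_ediv x m⟩
    rw [Set.mem_ofPred_eq, Int.emod_add_mul_ediv]
    exact hx
  refine Set.Finite.subset (Set.Finite.biUnion (Finset.finite_toSet _) fun r _ => ?_) hsub
  exact (h r).image _

theorem lemma3p7 (k m : ℕ) (hk : 1 ≤ k) (hm : 1 ≤ m) (δ : ℝ) (hδ : δ < 1 / 2)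
    (E : Set ℤ) (hE : E.Infinite) :
    ∃ S : Set ℤ, S.Finite ∧ (∀ n ∈ S, 0 < n) ∧ DeltaNonrecurrent δ S ∧
      dilate m S ⊆ E - E ∧ ChromaticallyRecurrent k (dilate m S) := by
  obtain ⟨r, hr⟩ := hE.exists_infinite_residue hm
  obtain ⟨S, hfin, hpos, hnon, hsub, hchrom⟩ := exists_nonrecurrent_chromatic k hδ hr
  refine ⟨S, hfin, hpos, hnon, ?_, ?_⟩
  · rintro _ ⟨n, hn, rfl⟩
    obtain ⟨x, hx, y, hy, rfl⟩ := hsub hn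
    exact ⟨r + m * x, hx, r + m * y, hy, by simp only; ring⟩
  · intro A _ hA
    have hcell (x : ℤ) : ∃ j, (m : ℤ) * x ∈ A j := by
      rw [← Set.mem_iUnion, hA]
      trivial
    choose f hf using hcell
    -- Each integer `x` is coloured by the cell that contains `m * x`.
    obtain ⟨x, y, hxy, hS⟩ := hchrom (fun x => f x) fun x => (f x).2
    refine ⟨f x, m * (x - y), ⟨m * x, hf x, m * y, ?_, by simp only; ring⟩, x - y, hS, rfl⟩
    rw [Fin.ext hxy]
    exact hf y
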